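/- Let $V$ be a finite set of nodes partitioned into $k$ classes $V_1,\dots,V_k$, $|V_a|=n_a$, and let $\tau_1,\dots,\tau_k$ and $\tau_0>0$ be real numbers with $\tau_a n_a\ge\tau_0$ for every $a$; all of these are fixed (independent of the dimension). For every feature dimension $d\ge 1$ consider the following random model: the class means $m_1,\dots,m_k$ are independent and uniformly distributed on the unit sphere $S^{d-1}\subset\mathbb{R}^d$; conditionally on $(m_1,\dots,m_k)$ the node features $x_p\in\mathbb{R}^d$ $(p\in V)$ are independent, and for $p\in V_a$ the vector $x_p$ has law $\mathcal{D}_a$, where $\mathcal{D}_a$ has finite second moments, mean $m_a$ and covariance matrix $\Sigma_a$ with $\operatorname{tr}\Sigma_a=\tau_a$. Let $X$ be the matrix with rows $x_p^\top$ and, for $C\in\mathbb{R}^{V\times V}$ and $Y=CX$, with rows $Y_p$, define $$\mathcal{L}(C)=\sum_{a=1}^k\frac1{n_a}\sum_{p\in V_a}\mathbb{E}\bigl[\|Y_p-m_a\|_2^2\,\big|\,m_1,\dots,m_k\bigr].$$ Then, for each $d\ge1$, almost surely $\mathcal{L}$ has a unique minimizer $C^*$ over $\mathbb{R}^{V\times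 V}$ (which is random through the class means), and there are random scalars $s_a^*$ and $\gamma_{ab}^*$ $(a\ne b)$ such that almost surely $$(C^*)_{V_a\times V_a}=s_a^*J_{V_a},\qquad (C^*)_{V_a\times V_b}=\gamma_{ab}^*J_{V_a,V_b}\quad(a\ne b),$$ where $J_{V_a}$ and $J_{V_a,V_b}$ are the all-ones blocks of sizes $n_a\times n_a$ and $n_a\times n_b$. As $d\to\infty$, $$s_a^*\xrightarrow{\ \mathbb{P}\ }\frac1{n_a+\tau_a},\qquad \gamma_{ab}^*\xrightarrow{\ \mathbb{P}\ }0\quad(a\ne b).$$ Consequently $C^*$ is asymptotically block-diagonal: in operator norm, $(C^*)_{V_a\times V_a}\xrightarrow{\mathbb{P}}\frac1{n_a+\tau_a}J_{V_a}$ for every $a$ and $(C^*)_{V_a\times V_b}\xrightarrow{\mathbb{P}}0$ for $a\ne b$. -/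

import Mathlib

open MeasureTheory ProbabilityTheory Filter Topology
open scoped Matrix.Norms.L2Operator

/-- The uniform probability distribution on the unit sphere `S^{d-1}` of `ℝ^d` (`d ≥ 1`), as a
measure on `ℝ^d`: the normalized surface measure, pushed forward along the inclusion. -/
noncomputable def uniformSphere (d : ℕ) : Measure (EuclideanSpace ℝ (Fin d)) :=
  (((volume : Measure (EuclideanSpace ℝ (Fin d))).toSphere Set.univ)⁻¹ •
    (volume : Measure (EuclideanSpace ℝ (Fin d))).toSphere).map Subtype.val

/-- The covariance matrix of a distribution on `ℝ^d`. -/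
noncomputable def featureCovariance {d : ℕ} (μ : Measure (EuclideanSpace ℝ (Fin d))) :
    Matrix (Fin d) (Fin d) ℝ :=
  Matrix.of fun i j =>
    covariance (fun x : EuclideanSpace ℝ (Fin d) => x i)
      (fun x : EuclideanSpace ℝ (Fin d) => x j) μ

/-- The number `n_a` of nodes of class `a`, for the class assignment `cls`. -/
def classSize {V : Type*} [Fintype V] {k : ℕ} (cls : V → Fin k) (a : Fin k) : ℕ :=
  (Finset.univ.filter fun p => cls p = a).card

/-- The random feature model in dimension `d`, on a probability space `(Ω, P)`: `m a` is the mean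
vector of class `a`, `X p` is the feature vector of node `p`, and `D a` is the class-conditional
feature distribution of class `a` (a kernel, since it depends on the class means). -/
structure IsClassFeatureModel {V : Type*} [Fintype V] {k d : ℕ} (cls : V → Fin k)
    (τ : Fin k → ℝ) {Ω : Type*} [MeasurableSpace Ω] (P : Measure Ω) [IsProbabilityMeasure P]
    (m : Fin k → Ω → EuclideanSpace ℝ (Fin d)) (X : V → Ω → EuclideanSpace ℝ (Fin d))
    (D : Fin k → Kernel (Fin k → EuclideanSpace ℝ (Fin d)) (EuclideanSpace ℝ (Fin d))) :
    Prop where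
  measurable_mean : ∀ a, Measurable (m a)
  measurable_feature : ∀ p, Measurable (X p)
  /-- The class means are independent. -/
  indep_mean : iIndepFun m P
  /-- Each class mean is uniform on the unit sphere. -/
  law_mean : ∀ a, P.map (m a) = uniformSphere d
  markov : ∀ a, IsMarkovKernel (D a)
  /-- Given the class means, the features are independent and `X p` has law `D (cls p)`. -/
  condLaw_feature : ∀ᵐ ω ∂P,
    condDistrib (fun ω p => X p ω) (fun ω a => m a ω) P (fun a => m a ω) =
      Measure.pi fun p => D (cls p) (fun b => m b ω)
  /-- `D a` has finite second moments, -/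
  memLp : ∀ᵐ ω ∂P, ∀ a, MemLp id 2 (D a (fun b => m b ω))
  /-- mean `m a`, -/
  mean_eq : ∀ᵐ ω ∂P, ∀ a, ∫ x, x ∂(D a (fun b => m b ω)) = m a ω
  /-- and a covariance matrix of trace `τ a`. -/
  trace_cov : ∀ᵐ ω ∂P, ∀ a, (featureCovariance (D a (fun b => m b ω))).trace = τ a

/-- Row `p` of `Y = C X`, where `x q` is row `q` of the feature matrix `X`. -/
noncomputable def propagate {V : Type*} [Fintype V] {d : ℕ} (C : Matrix V V ℝ)
    (x : V → EuclideanSpace ℝ (Fin d)) (p : V) : EuclideanSpace ℝ (Fin d) :=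
  ∑ q, C p q • x q

/-- The classwise mean squared error
`L(C) = ∑_a (1 / n_a) ∑_{p ∈ V_a} E ‖Y_p - m_a‖²`, `Y = C X`, where `E` is the expectation over the
features conditionally on the class means; it depends on `ω` only through the class means. -/
noncomputable def classwiseMSE {V : Type*} [Fintype V] {k d : ℕ} (cls : V → Fin k)
    {Ω : Type*} [MeasurableSpace Ω] (P : Measure Ω) [IsProbabilityMeasure P]
    (m : Fin k → Ω → EuclideanSpace ℝ (Fin d)) (X : V → Ω → EuclideanSpace ℝ (Fin d))
    (ω : Ω) (C : Matrix V V ℝ) : ℝ :=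
  ∑ a, (1 / (classSize cls a : ℝ)) * ∑ p with cls p = a,
    ∫ x, ‖propagate C x p - m a ω‖ ^ 2
      ∂(condDistrib (fun ω q => X q ω) (fun ω b => m b ω) P (fun b => m b ω))

/-- The block `C_{V_a × V_b}`. -/
def classBlock {V : Type*} {k : ℕ} (cls : V → Fin k) (C : Matrix V V ℝ) (a b : Fin k) :
    Matrix {p // cls p = a} {q // cls q = b} ℝ :=
  C.toBlock (fun p => cls p = a) (fun q => cls q = b)

/-- The all-ones block `J_{V_a, V_b}`; `J_{V_a}` is `onesBlock cls a a`. -/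
def onesBlock {V : Type*} {k : ℕ} (cls : V → Fin k) (a b : Fin k) :
    Matrix {p // cls p = a} {q // cls q = b} ℝ :=
  Matrix.of fun _ _ => 1

/-- Convergence in probability, as `d → ∞`, of `Z d` (defined on `(Ω d, P d)`) to the constant `c`;
the probability spaces may vary with `d`. -/
def TendstoInProb {Ω : ℕ → Type*} [∀ d, MeasurableSpace (Ω d)] (P : ∀ d, Measure (Ω d))
    {E : Type*} [PseudoMetricSpace E] (Z : ∀ d, Ω d → E) (c : E) : Prop :=
  ∀ ε : ℝ, 0 < ε → Tendsto (fun d => P d {ω | ε ≤ dist (Z d ω) c}) atTop (𝓝 0)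

/-! Conditionally on the class means, the features are independent, so a bias-variance decomposition
turns the contribution of row `p` into `‖∑ q, C p q • m (cls q) - m (cls p)‖² + ∑ q, C p q ^ 2 * τ
(cls q)`. The rows decouple into ridge regressions with positive penalties, each with a unique
minimizer given by its normal equations. Their data depend only on classes, hence so does the
solution `t`.

For target class `a`, the equation at class `b` reads `(n_b + τ_b) t_b + (terms t_c ⟪m_b, m_c⟫, c ≠
b) = ⟪m_b, m_a⟫`. Comparison with zero coefficients bounds `t` independently of `d`, so `t_b`
differs from its value for orthonormal means by at most a constant times `crossInner`
(`IsRidgeSolution.abs_sub_le`). Rotation invariance gives `E ⟪m_a, m_b⟫² = 1/d` for `a ≠ b`, and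
Chebyshev's inequality concludes. -/

/-! ### Rotation invariance and second moments of the uniform law on the sphere. -/

section UniformSphere

open scoped Pointwise RealInnerProductSpace ENNReal

theorem uniformSphere_apply {d : ℕ} {s : Set (EuclideanSpace ℝ (Fin d))} (hs : MeasurableSet s) :
    uniformSphere d s =
      ((volume : Measure (EuclideanSpace ℝ (Fin d))).toSphere Set.univ)⁻¹ *
        (d * volume (Set.Ioo (0 : ℝ) 1 • (s ∩ Metric.sphere (0 : EuclideanSpace ℝ (Fin d)) 1))) := by
  rw [uniformSphere, Measure.map_apply measurable_subtype_coe hs, Measure.smul_apply,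
    Measure.toSphere_apply' _ (measurable_subtype_coe hs), Subtype.image_preimage_coe,
    finrank_euclideanSpace_fin, smul_eq_mul, Set.inter_comm]

theorem isProbabilityMeasure_uniformSphere {d : ℕ} (hd : 1 ≤ d) :
    IsProbabilityMeasure (uniformSphere d) := by
  constructor
  have : Nonempty (Fin d) := ⟨⟨0, hd⟩⟩
  rw [uniformSphere, Measure.map_apply measurable_subtype_coe .univ, Set.preimage_univ,
    Measure.smul_apply, smul_eq_mul]
  exact ENNReal.inv_mul_cancel (Measure.measure_univ_ne_zero.2 (Measure.toSphere_ne_zero _)) (measure_ne_top _ _)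

theorem uniformSphere_ae_norm (d : ℕ) : ∀ᵐ x ∂uniformSphere d, ‖x‖ = 1 := by
  rw [uniformSphere, ae_map_iff measurable_subtype_coe.aemeasurable
    (measurableSet_eq_fun measurable_norm measurable_const)]
  exact Eventually.of_forall fun x => by simp

theorem uniformSphere_map_linearIsometryEquiv {d : ℕ}
    (L : EuclideanSpace ℝ (Fin d) ≃ₗᵢ[ℝ] EuclideanSpace ℝ (Fin d)) :
    (uniformSphere d).map L = uniformSphere d := by
  ext s hs
  have hL : Measurable L := L.continuous.measurable
  rw [Measure.map_apply hL hs, uniformSphere_apply (hL hs), uniformSphere_apply hs]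
  congr 2
  -- The surface measure is the volume of a cone up to a constant; `L` preserves volume and commutes
  -- with forming cones.
  conv_rhs => rw [← L.measurePreserving.measure_preimage_emb L.toHomeomorph.measurableEmbedding]
  congr 1
  ext x
  simp only [Set.mem_smul, Set.mem_inter_iff, Set.mem_preimage, mem_sphere_zero_iff_norm]
  constructor
  · rintro ⟨r, hr, y, ⟨hy, hy'⟩, rfl⟩
    exact ⟨r, hr, L y, ⟨hy, by simpa using hy'⟩, by simp⟩
  · rintro ⟨r, hr, y, ⟨hy, hy'⟩, h⟩
    exact ⟨r, hr, L.symm y, ⟨by simpa using hy, by simpa using hy'⟩, by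
      apply L.injective; simpa using h⟩

/-- The reflection in the hyperplane orthogonal to `v - w` exchanges `v` and `w` and preserves the
measure. -/
theorem lintegral_inner_sq_uniformSphere_congr {d : ℕ} {v w : EuclideanSpace ℝ (Fin d)}
    (h : ‖v‖ = ‖w‖) :
    ∫⁻ x, ENNReal.ofReal (⟪x, v⟫ ^ 2) ∂uniformSphere d =
      ∫⁻ x, ENNReal.ofReal (⟪x, w⟫ ^ 2) ∂uniformSphere d := by
  set R := (ℝ ∙ (v - w))ᗮ.reflection
  have hR : R v = w := Submodule.reflection_sub h
  rw [← uniformSphere_map_linearIsometryEquiv R, lintegral_map (by fun_prop) (by fun_prop),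
    uniformSphere_map_linearIsometryEquiv]
  refine lintegral_congr fun x => ?_
  rw [← hR, ← R.inner_map_map (R x) v, Submodule.reflection_reflection]

/-- All unit directions give the same integral, and the `d` coordinate directions sum to the
integral of `‖x‖² = 1`. -/
theorem lintegral_inner_sq_uniformSphere {d : ℕ} (hd : 1 ≤ d) {v : EuclideanSpace ℝ (Fin d)}
    (hv : ‖v‖ = 1) :
    ∫⁻ x, ENNReal.ofReal (⟪x, v⟫ ^ 2) ∂uniformSphere d = (d : ℝ≥0∞)⁻¹ := by
  have := isProbabilityMeasure_uniformSphere hd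
  have hsum : ∑ i : Fin d, ∫⁻ x, ENNReal.ofReal
      (⟪x, EuclideanSpace.single i (1 : ℝ)⟫ ^ 2) ∂uniformSphere d = 1 := by
    rw [← lintegral_finsetSum _ (fun i _ => by fun_prop)]
    rw [← measure_univ (μ := uniformSphere d), ← lintegral_one]
    refine lintegral_congr_ae ?_
    filter_upwards [uniformSphere_ae_norm d] with x hx
    rw [← ENNReal.ofReal_sum_of_nonneg (fun i _ => sq_nonneg _)]
    have : ∑ i, ⟪x, EuclideanSpace.single i (1 : ℝ)⟫ ^ 2 = ‖x‖ ^ 2 := by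
      rw [EuclideanSpace.real_norm_sq_eq]
      simp [EuclideanSpace.inner_single_right]
    rw [this, hx]; simp
  have hc : ∀ i : Fin d, ∫⁻ x, ENNReal.ofReal
      (⟪x, EuclideanSpace.single i (1 : ℝ)⟫ ^ 2) ∂uniformSphere d =
      ∫⁻ x, ENNReal.ofReal (⟪x, v⟫ ^ 2) ∂uniformSphere d := fun i =>
    lintegral_inner_sq_uniformSphere_congr (by simp [hv])
  simp only [hc, Finset.sum_const, Finset.card_univ, Fintype.card_fin, nsmul_eq_mul] at hsum
  rw [mul_comm] at hsum
  exact ENNReal.eq_inv_of_mul_eq_one_left hsum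

theorem lintegral_inner_sq_of_indepFun {d : ℕ} (hd : 1 ≤ d) {Ω : Type*} [MeasurableSpace Ω]
    {P : Measure Ω} [IsProbabilityMeasure P] {x y : Ω → EuclideanSpace ℝ (Fin d)}
    (hx : Measurable x) (hy : Measurable y) (hind : IndepFun x y P)
    (hxlaw : P.map x = uniformSphere d) (hylaw : P.map y = uniformSphere d) :
    ∫⁻ ω, ENNReal.ofReal (⟪x ω, y ω⟫ ^ 2) ∂P = (d : ℝ≥0∞)⁻¹ := by
  have := isProbabilityMeasure_uniformSphere hd
  have hm : Measurable fun z : EuclideanSpace ℝ (Fin d) × EuclideanSpace ℝ (Fin d) =>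
      ENNReal.ofReal (⟪z.1, z.2⟫ ^ 2) := by fun_prop
  rw [← lintegral_map (f := fun z : EuclideanSpace ℝ (Fin d) × EuclideanSpace ℝ (Fin d) =>
      ENNReal.ofReal (⟪z.1, z.2⟫ ^ 2)) hm (hx.prodMk hy),
    (indepFun_iff_map_prod_eq_prod_map_map hx.aemeasurable hy.aemeasurable).1 hind,
    hxlaw, hylaw, lintegral_prod _ hm.aemeasurable]
  rw [← mul_one (d : ℝ≥0∞)⁻¹, ← measure_univ (μ := uniformSphere d), ← lintegral_const]
  refine lintegral_congr_ae ?_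
  filter_upwards [uniformSphere_ae_norm d] with z hz
  simp_rw [real_inner_comm _ z]
  exact lintegral_inner_sq_uniformSphere hd hz

end UniformSphere

/-! ### Bias-variance decomposition under product measures. -/

section SecondMoment

theorem integral_sq_sum_sub_pi {V : Type*} [Fintype V] {Ω : V → Type*}
    [∀ q, MeasurableSpace (Ω q)] (μ : ∀ q, Measure (Ω q)) [∀ q, IsProbabilityMeasure (μ q)]
    (f : ∀ q, Ω q → ℝ) (hf : ∀ q, MemLp (f q) 2 (μ q)) (r : ℝ) :
    MemLp (fun x : ∀ q, Ω q => ∑ q, f q (x q) - r) 2 (Measure.pi μ) ∧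
    ∫ x, (∑ q, f q (x q) - r) ^ 2 ∂Measure.pi μ =
      (∑ q, ∫ y, f q y ∂μ q - r) ^ 2 + ∑ q, Var[f q; μ q] := by
  have hq : ∀ q, MemLp (fun x : ∀ q, Ω q => f q (x q)) 2 (Measure.pi μ) := fun q =>
    (hf q).comp_measurePreserving (measurePreserving_eval μ q)
  have hS : MemLp (fun x : ∀ q, Ω q => ∑ q, f q (x q)) 2 (Measure.pi μ) :=
    memLp_finsetSum _ fun q _ => hq q
  have hSr : MemLp (fun x : ∀ q, Ω q => ∑ q, f q (x q) - r) 2 (Measure.pi μ) :=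
    hS.sub (memLp_const r)
  refine ⟨hSr, ?_⟩
  have hv := variance_sum_pi (μ := μ) hf
  have he : (∑ q, fun x : ∀ q, Ω q => f q (x q)) = fun x => ∑ q, f q (x q) := by
    ext x; simp
  rw [he, ← variance_sub_const hS.aestronglyMeasurable r, variance_eq_sub hSr] at hv
  have hI : ∫ x, (∑ q, f q (x q) - r) ∂Measure.pi μ = ∑ q, ∫ y, f q y ∂μ q - r := by
    rw [integral_sub (hS.integrable one_le_two) (integrable_const r),
      integral_finsetSum _ fun q _ => (hq q).integrable one_le_two]
    simp only [integral_const, probReal_univ, one_smul]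
    congr 1
    exact Finset.sum_congr rfl fun q _ =>
      integral_comp_eval (hf q).aestronglyMeasurable
  rw [hI] at hv
  simp only [Pi.pow_apply] at hv
  linarith

theorem integral_norm_sq_propagate_sub_pi {V : Type*} [Fintype V] {d : ℕ}
    (μ : V → Measure (EuclideanSpace ℝ (Fin d))) [∀ q, IsProbabilityMeasure (μ q)]
    (hμ : ∀ q, MemLp id 2 (μ q)) (C : Matrix V V ℝ) (p : V) (r : EuclideanSpace ℝ (Fin d)) :
    ∫ x, ‖propagate C x p - r‖ ^ 2 ∂Measure.pi μ =
      ‖∑ q, C p q • ∫ y, y ∂μ q - r‖ ^ 2 + ∑ q, C p q ^ 2 * (featureCovariance (μ q)).trace := by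
  have hcoord : ∀ q i, MemLp (fun y : EuclideanSpace ℝ (Fin d) => y i) 2 (μ q) := fun q i =>
    (hμ q).continuousLinearMap_comp (EuclideanSpace.proj (𝕜 := ℝ) i)
  have hmean : ∀ q i, (∫ y, y ∂μ q) i = ∫ y, y i ∂μ q := fun q i =>
    ((EuclideanSpace.proj (𝕜 := ℝ) i).integral_comp_comm ((hμ q).integrable one_le_two)).symm
  have key := fun i => integral_sq_sum_sub_pi μ (fun q y => C p q * y i)
    (fun q => (hcoord q i).const_mul (C p q)) (r i)
  simp only [EuclideanSpace.real_norm_sq_eq, propagate, PiLp.sub_apply, WithLp.ofLp_sum,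
    Finset.sum_apply, smul_eq_mul, WithLp.ofLp_smul, Pi.smul_apply]
  rw [integral_finsetSum _ fun i _ => (key i).1.integrable_sq]
  simp only [(key _).2, Finset.sum_add_distrib, integral_const_mul, hmean]
  congr 1
  rw [Finset.sum_comm]
  refine Finset.sum_congr rfl fun q _ => ?_
  simp only [variance_const_mul, ← Finset.mul_sum, Matrix.trace, featureCovariance,
    Matrix.diag_apply, Matrix.of_apply]
  congr 1
  exact Finset.sum_congr rfl fun i _ =>
    (covariance_self (hcoord q i).aestronglyMeasurable.aemeasurable).symm

end SecondMoment

/-! ### Weighted ridge regression in an inner product space. -/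

section Ridge

open scoped RealInnerProductSpace

variable {V : Type*} [Fintype V] {E : Type*} [NormedAddCommGroup E] [InnerProductSpace ℝ E]

/-- The weighted ridge-regression loss of the coefficients `c`, for regressors `x`, penalties `σ`
and target `v`. -/
noncomputable def ridgeLoss (x : V → E) (σ : V → ℝ) (v : E) (c : V → ℝ) : ℝ :=
  ‖∑ q, c q • x q - v‖ ^ 2 + ∑ q, c q ^ 2 * σ q

/-- The normal equations of `ridgeLoss`. -/
def IsRidgeSolution (x : V → E) (σ : V → ℝ) (v : E) (c : V → ℝ) : Prop :=
  ∀ q, ⟪x q, ∑ j, c j • x j⟫ + σ q * c q = ⟪x q, v⟫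

theorem exists_isRidgeSolution (x : V → E) {σ : V → ℝ} (hσ : ∀ q, 0 < σ q) (v : E) :
    ∃ c, IsRidgeSolution x σ v c := by
  let T : (V → ℝ) →ₗ[ℝ] (V → ℝ) :=
    { toFun := fun c q => ⟪x q, ∑ j, c j • x j⟫ + σ q * c q
      map_add' := fun c c' => by
        ext q
        simp only [Pi.add_apply, add_smul, Finset.sum_add_distrib, inner_add_right]
        ring
      map_smul' := fun r c => by
        ext q
        simp only [Pi.smul_apply, smul_eq_mul, mul_smul, ← Finset.smul_sum, inner_smul_right,
          RingHom.id_apply]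
        ring }
  -- Pairing the homogeneous equations with `c` gives a vanishing sum of nonnegative terms; in
  -- finite dimension injectivity yields surjectivity.
  have hinj : Function.Injective T := by
    rw [← LinearMap.ker_eq_bot, LinearMap.ker_eq_bot']
    intro c hc
    have h0 : ∀ q, ⟪x q, ∑ j, c j • x j⟫ + σ q * c q = 0 := fun q => congrFun hc q
    have h1 : ‖∑ j, c j • x j‖ ^ 2 + ∑ q, c q ^ 2 * σ q = 0 := by
      rw [← real_inner_self_eq_norm_sq, sum_inner, ← Finset.sum_add_distrib]
      refine Finset.sum_eq_zero fun q _ => ?_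
      rw [real_inner_smul_left]
      linear_combination c q * h0 q
    have h2 : ∑ q, c q ^ 2 * σ q = 0 := le_antisymm (by nlinarith [sq_nonneg ‖∑ j, c j • x j‖])
      (Finset.sum_nonneg fun q _ => mul_nonneg (sq_nonneg _) (hσ q).le)
    ext q
    have := (Finset.sum_eq_zero_iff_of_nonneg
      (fun q _ => mul_nonneg (sq_nonneg (c q)) (hσ q).le)).1 h2 q (Finset.mem_univ q)
    simpa [(hσ q).ne'] using this
  obtain ⟨c, hc⟩ := LinearMap.injective_iff_surjective.1 hinj fun q => ⟪x q, v⟫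
  exact ⟨c, fun q => congrFun hc q⟩

namespace IsRidgeSolution

variable {x : V → E} {σ : V → ℝ} {v : E} {c : V → ℝ}

/-- The normal equations cancel the cross terms, so the quadratic expansion around `c` is exact.
Uniqueness and the a priori bounds follow from it. -/
theorem ridgeLoss_eq_add (hc : IsRidgeSolution x σ v c) (h : V → ℝ) :
    ridgeLoss x σ v h = ridgeLoss x σ v c + ridgeLoss x σ 0 (h - c) := by
  have hsplit : ∑ q, h q • x q - v =
      (∑ q, c q • x q - v) + ∑ q, (h - c) q • x q := by
    simp only [Pi.sub_apply, sub_smul, Finset.sum_sub_distrib]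
    abel
  have hcross : ⟪∑ q, c q • x q - v, ∑ q, (h - c) q • x q⟫ =
      - ∑ q, (h q - c q) * (σ q * c q) := by
    rw [inner_sum, ← Finset.sum_neg_distrib]
    refine Finset.sum_congr rfl fun q _ => ?_
    rw [real_inner_smul_right, real_inner_comm, inner_sub_right, Pi.sub_apply]
    linear_combination (h q - c q) * hc q
  have hpen : ∑ q, h q ^ 2 * σ q = ∑ q, c q ^ 2 * σ q +
      2 * ∑ q, (h q - c q) * (σ q * c q) + ∑ q, (h - c) q ^ 2 * σ q := by
    rw [Finset.mul_sum, ← Finset.sum_add_distrib, ← Finset.sum_add_distrib]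
    refine Finset.sum_congr rfl fun q _ => ?_
    rw [Pi.sub_apply]
    ring
  unfold ridgeLoss
  rw [hsplit, norm_add_sq_real, hcross, hpen, sub_zero]
  ring

/-- The loss at `c` is at most the loss at zero coefficients, which is `‖v‖ ^ 2 = 1`. -/
theorem sq_mul_le_one (hc : IsRidgeSolution x σ v c) (hσ : ∀ q, 0 < σ q) (hv : ‖v‖ = 1) (q : V) :
    c q ^ 2 * σ q ≤ 1 := by
  have h := hc.ridgeLoss_eq_add 0
  have h0 : ridgeLoss x σ v 0 = 1 := by simp [ridgeLoss, hv]
  have h1 : 0 ≤ ridgeLoss x σ 0 (0 - c) :=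
    add_nonneg (sq_nonneg _) (Finset.sum_nonneg fun q _ => mul_nonneg (sq_nonneg _) (hσ q).le)
  have h2 : c q ^ 2 * σ q ≤ ∑ q, c q ^ 2 * σ q :=
    Finset.single_le_sum (f := fun q => c q ^ 2 * σ q)
      (fun q _ => mul_nonneg (sq_nonneg _) (hσ q).le) (Finset.mem_univ q)
  have h3 : ∑ q, c q ^ 2 * σ q ≤ ridgeLoss x σ v c := le_add_of_nonneg_left (sq_nonneg _)
  linarith

theorem abs_le (hc : IsRidgeSolution x σ v c) (hσ : ∀ q, 0 < σ q) (hv : ‖v‖ = 1) (q : V) :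
    |c q| ≤ 1 + 1 / σ q := by
  have h : c q ^ 2 ≤ 1 / σ q := (le_div_iff₀ (hσ q)).2 (hc.sq_mul_le_one hσ hv q)
  have := sq_abs (c q)
  nlinarith [sq_nonneg (|c q| - 1), abs_nonneg (c q)]

end IsRidgeSolution

theorem ridgeLoss_zero_eq_zero_iff {x : V → E} {σ : V → ℝ} (hσ : ∀ q, 0 < σ q) {c : V → ℝ} :
    ridgeLoss x σ 0 c = 0 ↔ c = 0 := by
  have hn : ∀ q, 0 ≤ c q ^ 2 * σ q := fun q => mul_nonneg (sq_nonneg _) (hσ q).le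
  constructor
  · intro h
    have h2 : ∑ q, c q ^ 2 * σ q = 0 :=
      ((add_eq_zero_iff_of_nonneg (sq_nonneg _) (Finset.sum_nonneg fun q _ => hn q)).1 h).2
    ext q
    simpa [(hσ q).ne'] using
      (Finset.sum_eq_zero_iff_of_nonneg fun q _ => hn q).1 h2 q (Finset.mem_univ q)
  · rintro rfl
    simp [ridgeLoss]

/-- The minimizer of a positive combination of rowwise ridge losses is the matrix whose rows solve
the normal equations. -/
theorem isMinOn_sum_ridgeLoss_iff {x : V → E} {σ : V → ℝ} (hσ : ∀ q, 0 < σ q) {v : V → E}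
    {w : V → ℝ} (hw : ∀ p, 0 < w p) {C₀ : Matrix V V ℝ}
    (hC₀ : ∀ p, IsRidgeSolution x σ (v p) (C₀ p)) {C : Matrix V V ℝ} :
    IsMinOn (fun C : Matrix V V ℝ => ∑ p, w p * ridgeLoss x σ (v p) (C p)) Set.univ C ↔
      C = C₀ := by
  have hnn : ∀ c : V → ℝ, 0 ≤ ridgeLoss x σ 0 c := fun c =>
    add_nonneg (sq_nonneg _) (Finset.sum_nonneg fun q _ => mul_nonneg (sq_nonneg _) (hσ q).le)
  have hexp : ∀ B : Matrix V V ℝ, ∑ p, w p * ridgeLoss x σ (v p) (B p) =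
      ∑ p, w p * ridgeLoss x σ (v p) (C₀ p) + ∑ p, w p * ridgeLoss x σ 0 (B p - C₀ p) := by
    intro B
    rw [← Finset.sum_add_distrib]
    exact Finset.sum_congr rfl fun p _ => by rw [(hC₀ p).ridgeLoss_eq_add (B p), mul_add]
  have hterm : ∀ (B : Matrix V V ℝ) p, 0 ≤ w p * ridgeLoss x σ 0 (B p - C₀ p) := fun B p =>
    mul_nonneg (hw p).le (hnn _)
  constructor
  · intro h
    have h1 := isMinOn_univ_iff.1 h C₀
    rw [hexp C] at h1
    have h2 : ∑ p, w p * ridgeLoss x σ 0 (C p - C₀ p) = 0 :=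
      le_antisymm (by linarith) (Finset.sum_nonneg fun p _ => hterm C p)
    funext p
    have h3 := (Finset.sum_eq_zero_iff_of_nonneg fun p _ => hterm C p).1 h2 p (Finset.mem_univ p)
    exact sub_eq_zero.1 ((ridgeLoss_zero_eq_zero_iff hσ).1
      ((mul_eq_zero.1 h3).resolve_left (hw p).ne'))
  · rintro rfl
    refine isMinOn_univ_iff.2 fun B => ?_
    rw [hexp B]
    exact le_add_of_nonneg_right (Finset.sum_nonneg fun p _ => hterm B p)

end Ridge

/-! ### Ridge solutions for class-dependent data and nearly orthogonal means. -/

section ClassRidge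

open scoped RealInnerProductSpace

variable {V : Type*} [Fintype V] {k : ℕ} {E : Type*} [NormedAddCommGroup E]
  [InnerProductSpace ℝ E]

/-- The sum of the absolute inner products of distinct vectors of a family. -/
noncomputable def crossInner (m : Fin k → E) : ℝ :=
  ∑ x ∈ Finset.univ.offDiag, |⟪m x.1, m x.2⟫|

theorem abs_inner_le_crossInner (m : Fin k → E) {a b : Fin k} (h : a ≠ b) :
    |⟪m a, m b⟫| ≤ crossInner m := by
  have hmem : (a, b) ∈ (Finset.univ : Finset (Fin k)).offDiag := by simpa using h
  exact Finset.single_le_sum (f := fun x : Fin k × Fin k => |⟪m x.1, m x.2⟫|)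
    (fun _ _ => abs_nonneg _) hmem

theorem crossInner_nonneg (m : Fin k → E) : 0 ≤ crossInner m :=
  Finset.sum_nonneg fun _ _ => abs_nonneg _

/-- When the regressors and the penalties depend only on the class, so does the solution. -/
theorem exists_isRidgeSolution_comp (cls : V → Fin k) {τ : Fin k → ℝ} (hτ : ∀ a, 0 < τ a)
    (m : Fin k → E) (v : E) :
    ∃ t : Fin k → ℝ,
      IsRidgeSolution (fun q => m (cls q)) (fun q => τ (cls q)) v fun q => t (cls q) := by
  obtain ⟨c, hc⟩ := exists_isRidgeSolution (fun q => m (cls q)) (fun q => hτ (cls q)) v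
  -- The normal equation at `q`, solved for the `c q` of its penalty term, has a right side
  -- depending on `q` only through its class.
  refine ⟨fun b => (⟪m b, v⟫ - ⟪m b, ∑ j, c j • m (cls j)⟫) / τ b, ?_⟩
  convert hc using 1
  funext q
  rw [div_eq_iff (hτ _).ne']
  linear_combination -hc q

theorem IsRidgeSolution.abs_sub_le {cls : V → Fin k} {τ : Fin k → ℝ} (hτ : ∀ a, 0 < τ a)
    {m : Fin k → E} (hm : ∀ a, ‖m a‖ = 1) {a : Fin k} {t : Fin k → ℝ}
    (ht : IsRidgeSolution (fun q => m (cls q)) (fun q => τ (cls q)) (m a) fun q => t (cls q))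
    {q : V} :
    |t (cls q) - if a = cls q then 1 / ((classSize cls (cls q) : ℝ) + τ (cls q)) else 0| ≤
      (1 + ∑ j, (1 + 1 / τ (cls j))) / τ (cls q) * crossInner m := by
  set b := cls q
  set n : ℝ := (classSize cls b : ℝ)
  set S := crossInner m
  have hS : 0 ≤ S := crossInner_nonneg m
  have hτb := hτ b
  have hpos : 0 < n + τ b := by positivity
  have hdiag : ∀ a, ⟪m a, m a⟫ = 1 := fun a => by rw [real_inner_self_eq_norm_sq, hm, one_pow]
  have hin : ⟪m b, ∑ j, t (cls j) • m (cls j)⟫ =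
      n * t b + ∑ j with cls j ≠ b, t (cls j) * ⟪m b, m (cls j)⟫ := by
    simp only [inner_sum, real_inner_smul_right]
    rw [← Finset.sum_filter_add_sum_filter_not Finset.univ (fun j => cls j = b)]
    congr 1
    rw [Finset.sum_congr rfl (g := fun _ => t b), Finset.sum_const, nsmul_eq_mul]
    · rfl
    · intro j hj
      rw [(Finset.mem_filter.1 hj).2, hdiag, mul_one]
  have hrest : |∑ j with cls j ≠ b, t (cls j) * ⟪m b, m (cls j)⟫| ≤
      (∑ j, (1 + 1 / τ (cls j))) * S := by
    rw [Finset.sum_mul]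
    refine (Finset.abs_sum_le_sum_abs _ _).trans ((Finset.sum_le_sum fun j hj => ?_).trans
      (Finset.sum_le_univ_sum_of_nonneg fun j => by have := hτ (cls j); positivity))
    rw [abs_mul]
    have := hτ (cls j)
    exact mul_le_mul (ht.abs_le (fun q => hτ (cls q)) (hm a) j)
      (abs_inner_le_crossInner m (Finset.mem_filter.1 hj).2.symm) (abs_nonneg _) (by positivity)
  have heq : ⟪m b, ∑ j, t (cls j) • m (cls j)⟫ + τ b * t b = ⟪m b, m a⟫ := ht q
  have hrhs : |⟪m b, m a⟫ - if a = b then 1 else 0| ≤ S := by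
    split_ifs with h
    · rw [h, hdiag]; simpa using hS
    · rw [sub_zero]; exact abs_inner_le_crossInner m (Ne.symm h)
  have hmul : (n + τ b) * (t b - if a = b then 1 / (n + τ b) else 0) =
      (⟪m b, m a⟫ - if a = b then 1 else 0) -
        ∑ j with cls j ≠ b, t (cls j) * ⟪m b, m (cls j)⟫ := by
    have : (n + τ b) * (if a = b then 1 / (n + τ b) else 0) = if a = b then 1 else 0 := by
      split_ifs
      · field_simp
      · simp
    rw [mul_sub, this]
    linear_combination heq - hin
  have habs : (n + τ b) * |t b - if a = b then 1 / (n + τ b) else 0| ≤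
      (1 + ∑ j, (1 + 1 / τ (cls j))) * S := by
    rw [← abs_of_pos hpos, ← abs_mul, abs_of_pos hpos, hmul]
    refine (abs_sub _ _).trans ?_
    linarith
  -- Dividing by `τ b` instead of `n + τ b` loses only a constant factor.
  rw [div_mul_eq_mul_div, le_div_iff₀ hτb, mul_comm]
  refine le_trans (mul_le_mul_of_nonneg_right ?_ (abs_nonneg _)) habs
  exact le_add_of_nonneg_left (Nat.cast_nonneg _)

end ClassRidge

/-! ### Convergence in probability from second moments. -/

section Convergence

open scoped RealInnerProductSpace ENNReal

/-- A Chebyshev criterion: random elements at distance at most `K * S d` from `c`, where the second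
moment of `S d` is `O(1/d)`, converge to `c` in probability. -/
theorem tendstoInProb_of_ae_dist_le {Ω : ℕ → Type*} [∀ d, MeasurableSpace (Ω d)]
    {P : ∀ d, Measure (Ω d)} {E : Type*} [PseudoMetricSpace E] {Z : ∀ d, Ω d → E} {c : E}
    {S : ∀ d, Ω d → ℝ} {K : ℝ} {B : ℝ≥0∞} (hB : B ≠ ⊤)
    (hS : ∀ d, 1 ≤ d → AEMeasurable (S d) (P d))
    (hle : ∀ d, 1 ≤ d → ∀ᵐ ω ∂P d, dist (Z d ω) c ≤ K * S d ω)
    (hint : ∀ d, 1 ≤ d → ∫⁻ ω, ENNReal.ofReal (S d ω ^ 2) ∂P d ≤ B * (d : ℝ≥0∞)⁻¹) :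
    TendstoInProb P Z c := by
  -- The threshold uses `|K| + 1` so as to be positive whatever the sign of `K`.
  intro ε hε
  have hr : 0 < (ε / (|K| + 1)) ^ 2 := by positivity
  have hr' : ENNReal.ofReal ((ε / (|K| + 1)) ^ 2) ≠ 0 := (ENNReal.ofReal_pos.2 hr).ne'
  have hlim : Tendsto (fun d : ℕ => B * (d : ℝ≥0∞)⁻¹ / ENNReal.ofReal ((ε / (|K| + 1)) ^ 2))
      atTop (𝓝 0) := by
    have h1 : Tendsto (fun d : ℕ => B * (d : ℝ≥0∞)⁻¹) atTop (𝓝 (B * 0)) :=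
      ENNReal.Tendsto.const_mul ENNReal.tendsto_inv_nat_nhds_zero (Or.inr hB)
    simpa using ENNReal.Tendsto.div_const h1 (Or.inr hr')
  refine tendsto_of_tendsto_of_tendsto_of_le_of_le' tendsto_const_nhds hlim
    (Eventually.of_forall fun _ => zero_le) ?_
  filter_upwards [eventually_ge_atTop 1] with d hd
  calc P d {ω | ε ≤ dist (Z d ω) c}
      ≤ P d {ω | ENNReal.ofReal ((ε / (|K| + 1)) ^ 2) ≤ ENNReal.ofReal (S d ω ^ 2)} := by
        -- Monotonicity holds for outer measure, so `Z d` need not be measurable.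
        refine measure_mono_ae ?_
        filter_upwards [hle d hd] with ω hω hεω
        have h1 : ε ≤ (|K| + 1) * |S d ω| := by
          have h2 : K * S d ω ≤ |K| * |S d ω| := (le_abs_self _).trans (abs_mul _ _).le
          have h3 : ε ≤ dist (Z d ω) c := hεω
          nlinarith [abs_nonneg (S d ω)]
        have h2 : ε / (|K| + 1) ≤ |S d ω| := by
          rw [div_le_iff₀ (by positivity), mul_comm]; exact h1
        refine ENNReal.ofReal_le_ofReal ?_
        rw [← sq_abs (S d ω)]
        gcongr
    _ ≤ (∫⁻ ω, ENNReal.ofReal (S d ω ^ 2) ∂P d) / ENNReal.ofReal ((ε / (|K| + 1)) ^ 2) :=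
        meas_ge_le_lintegral_div ((hS d hd).pow_const 2).ennreal_ofReal hr' ENNReal.ofReal_ne_top
    _ ≤ _ := by gcongr; exact hint d hd

/-- Cauchy–Schwarz costs one factor of the number of pairs; summing the moments `1/d` over the pairs
gives the other. -/
theorem lintegral_crossInner_sq_le {k d : ℕ} (hd : 1 ≤ d) {Ω : Type*} [MeasurableSpace Ω]
    {P : Measure Ω} [IsProbabilityMeasure P] {m : Fin k → Ω → EuclideanSpace ℝ (Fin d)}
    (hm : ∀ a, Measurable (m a)) (hind : iIndepFun m P)
    (hlaw : ∀ a, P.map (m a) = uniformSphere d) :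
    ∫⁻ ω, ENNReal.ofReal (crossInner (fun a => m a ω) ^ 2) ∂P ≤
      ((Finset.univ : Finset (Fin k)).offDiag.card : ℝ≥0∞) ^ 2 * (d : ℝ≥0∞)⁻¹ := by
  set T := (Finset.univ : Finset (Fin k)).offDiag with hT
  calc ∫⁻ ω, ENNReal.ofReal (crossInner (fun a => m a ω) ^ 2) ∂P
      ≤ ∫⁻ ω, (T.card : ℝ≥0∞) * ∑ x ∈ T, ENNReal.ofReal (⟪m x.1 ω, m x.2 ω⟫ ^ 2) ∂P := by
        refine lintegral_mono fun ω => ?_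
        rw [← ENNReal.ofReal_sum_of_nonneg fun _ _ => sq_nonneg _, ← ENNReal.ofReal_natCast,
          ← ENNReal.ofReal_mul (Nat.cast_nonneg _)]
        refine ENNReal.ofReal_le_ofReal ?_
        have := sq_sum_le_card_mul_sum_sq (s := T)
          (f := fun x : Fin k × Fin k => |⟪m x.1 ω, m x.2 ω⟫|)
        simpa only [sq_abs, crossInner] using this
    _ = (T.card : ℝ≥0∞) * ∑ x ∈ T, (d : ℝ≥0∞)⁻¹ := by
        rw [lintegral_const_mul' _ _ (ENNReal.natCast_ne_top _), lintegral_finsetSum]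
        · congr 1
          refine Finset.sum_congr rfl fun x hx => ?_
          exact lintegral_inner_sq_of_indepFun hd (hm _) (hm _)
            (hind.indepFun (Finset.mem_offDiag.1 hx).2.2) (hlaw _) (hlaw _)
        · intro x _
          exact (((hm x.1).inner (hm x.2)).pow_const 2).ennreal_ofReal
    _ = _ := by rw [Finset.sum_const, nsmul_eq_mul, ← mul_assoc, sq]

end Convergence

/-! ### The conditional loss as a sum of ridge losses. -/

section Model

variable {V : Type*} [Fintype V] {k d : ℕ} {cls : V → Fin k} {τ : Fin k → ℝ}
  {Ω : Type*} [MeasurableSpace Ω] {P : Measure Ω} [IsProbabilityMeasure P]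
  {m : Fin k → Ω → EuclideanSpace ℝ (Fin d)} {X : V → Ω → EuclideanSpace ℝ (Fin d)}
  {D : Fin k → Kernel (Fin k → EuclideanSpace ℝ (Fin d)) (EuclideanSpace ℝ (Fin d))}

namespace IsClassFeatureModel

theorem ae_norm_mean (h : IsClassFeatureModel cls τ P m X D) :
    ∀ᵐ ω ∂P, ∀ a, ‖m a ω‖ = 1 := by
  refine ae_all_iff.2 fun a => ae_of_ae_map (h.measurable_mean a).aemeasurable
    (p := fun x : EuclideanSpace ℝ (Fin d) => ‖x‖ = 1) ?_
  rw [h.law_mean]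
  exact uniformSphere_ae_norm d

/-- The bias-variance decomposition of the loss. -/
theorem ae_classwiseMSE_eq (h : IsClassFeatureModel cls τ P m X D) :
    ∀ᵐ ω ∂P, classwiseMSE cls P m X ω = fun C : Matrix V V ℝ =>
      ∑ p, 1 / (classSize cls (cls p) : ℝ) *
        ridgeLoss (fun q => m (cls q) ω) (fun q => τ (cls q)) (m (cls p) ω) (C p) := by
  filter_upwards [h.condLaw_feature, h.memLp, h.mean_eq, h.trace_cov] with ω h1 h2 h3 h4
  have := h.markov
  funext C
  unfold classwiseMSE ridgeLoss
  rw [← Finset.sum_fiberwise Finset.univ cls]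
  refine Finset.sum_congr rfl fun a _ => ?_
  rw [Finset.mul_sum]
  refine Finset.sum_congr rfl fun p hp => ?_
  rw [(Finset.mem_filter.1 hp).2, h1, integral_norm_sq_propagate_sub_pi _ fun q => h2 (cls q)]
  simp only [h3, h4]

/-- Almost surely the loss has a unique minimizer, which is constant on the blocks and close to the
block-diagonal limit when the class means are nearly orthogonal. -/
theorem ae_minimizer (h : IsClassFeatureModel cls τ P m X D) (hτ : ∀ a, 0 < τ a) :
    ∀ᵐ ω ∂P, ∃ t : Fin k → Fin k → ℝ,
      (∀ C : Matrix V V ℝ, IsMinOn (classwiseMSE cls P m X ω) Set.univ C ↔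
        C = Matrix.of fun p q => t (cls p) (cls q)) ∧
      ∀ a (q : V),
        |t a (cls q) - if a = cls q then 1 / ((classSize cls (cls q) : ℝ) + τ (cls q)) else 0| ≤
          (1 + ∑ j, (1 + 1 / τ (cls j))) / τ (cls q) * crossInner fun b => m b ω := by
  filter_upwards [h.ae_norm_mean, h.ae_classwiseMSE_eq] with ω h1 h2
  choose t ht using fun a => exists_isRidgeSolution_comp cls hτ (fun b => m b ω) (m a ω)
  refine ⟨t, fun C => ?_, fun a q => (ht a).abs_sub_le hτ h1⟩
  rw [h2]
  refine isMinOn_sum_ridgeLoss_iff (fun q => hτ (cls q)) (fun p => ?_) fun p => ht (cls p)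
  have : 0 < classSize cls (cls p) :=
    Finset.card_pos.2 ⟨p, Finset.mem_filter.2 ⟨Finset.mem_univ p, rfl⟩⟩
  positivity

end IsClassFeatureModel

end Model

theorem mainTheorem4 {V : Type*} [Fintype V] [DecidableEq V] {k : ℕ} (cls : V → Fin k)
    (τ : Fin k → ℝ) (τ₀ : ℝ) (hτ₀ : 0 < τ₀)
    (hτ : ∀ a, τ₀ ≤ τ a * (classSize cls a : ℝ))
    {Ω : ℕ → Type*} [∀ d, MeasurableSpace (Ω d)] (P : ∀ d, Measure (Ω d))
    [∀ d, IsProbabilityMeasure (P d)]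
    (m : ∀ d, Fin k → Ω d → EuclideanSpace ℝ (Fin d))
    (X : ∀ d, V → Ω d → EuclideanSpace ℝ (Fin d))
    (D : ∀ d, Fin k → Kernel (Fin k → EuclideanSpace ℝ (Fin d)) (EuclideanSpace ℝ (Fin d)))
    (hmodel : ∀ d, 1 ≤ d → IsClassFeatureModel cls τ (P d) (m d) (X d) (D d)) :
    -- the minimizer of the loss exists and is unique, almost surely
    (∀ d, 1 ≤ d → ∀ᵐ ω ∂(P d), ∃! C : Matrix V V ℝ,
      IsMinOn (classwiseMSE cls (P d) (m d) (X d) ω) Set.univ C) ∧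
    -- and every choice of it has the asserted structure and limits
    ∀ Cstar : ∀ d, Ω d → Matrix V V ℝ,
      (∀ d, 1 ≤ d → ∀ᵐ ω ∂(P d),
        IsMinOn (classwiseMSE cls (P d) (m d) (X d) ω) Set.univ (Cstar d ω)) →
      ∃ (s : Fin k → ∀ d, Ω d → ℝ) (γ : Fin k → Fin k → ∀ d, Ω d → ℝ),
        (∀ d, 1 ≤ d → ∀ᵐ ω ∂(P d),
          (∀ a, classBlock cls (Cstar d ω) a a = s a d ω • onesBlock cls a a) ∧
          (∀ a b, a ≠ b → classBlock cls (Cstar d ω) a b = γ a b d ω • onesBlock cls a b)) ∧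
        (∀ a, TendstoInProb P (s a) (1 / ((classSize cls a : ℝ) + τ a))) ∧
        (∀ a b, a ≠ b → TendstoInProb P (γ a b) 0) ∧
        (∀ a, TendstoInProb P (fun d ω => classBlock cls (Cstar d ω) a a)
          ((1 / ((classSize cls a : ℝ) + τ a)) • onesBlock cls a a)) ∧
        (∀ a b, a ≠ b → TendstoInProb P (fun d ω => classBlock cls (Cstar d ω) a b) 0) := by
  -- Positivity of `τ a * n_a` forces both `τ a > 0` and a nonempty class, from which a
  -- representative `r a` is chosen.
  have hprod : ∀ a, 0 < τ a * (classSize cls a : ℝ) := fun a => hτ₀.trans_le (hτ a)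
  have hτpos : ∀ a, 0 < τ a := fun a => pos_of_mul_pos_left (hprod a) (Nat.cast_nonneg _)
  have hne : ∀ a, ∃ p, cls p = a := fun a => by
    have h0 : 0 < classSize cls a := Nat.pos_of_ne_zero fun h => by simpa [h] using hprod a
    obtain ⟨p, hp⟩ := Finset.card_pos.1 h0
    exact ⟨p, (Finset.mem_filter.1 hp).2⟩
  choose r hr using hne
  refine ⟨fun d hd => ?_, fun Cstar hC => ?_⟩
  · filter_upwards [(hmodel d hd).ae_minimizer hτpos] with ω ⟨t, ht, _⟩
    exact ⟨_, (ht _).2 rfl, fun C hC => (ht C).1 hC⟩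
  set M : ℝ := 1 + ∑ j, (1 + 1 / τ (cls j))
  set S : ∀ d, Ω d → ℝ := fun d ω => crossInner fun a => m d a ω
  set l : Fin k → Fin k → ℝ := fun a b => if a = b then 1 / ((classSize cls b : ℝ) + τ b) else 0
  -- The scalars are entries of `Cstar` at class representatives, defined for every `ω`; they equal
  -- the ridge coefficients almost surely.
  set z : Fin k → Fin k → ∀ d, Ω d → ℝ := fun a b d ω => Cstar d ω (r a) (r b)
  have hz : ∀ d, 1 ≤ d → ∀ᵐ ω ∂P d, ∀ a b,
      classBlock cls (Cstar d ω) a b = z a b d ω • onesBlock cls a b ∧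
        dist (z a b d ω) (l a b) ≤ M / τ b * S d ω := by
    intro d hd
    filter_upwards [(hmodel d hd).ae_minimizer hτpos, hC d hd] with ω ⟨t, ht, hbound⟩ hmin a b
    have hCt := (ht _).1 hmin
    have hzt : z a b d ω = t a b := by simp [z, hCt, hr]
    constructor
    · ext p q
      simp [hzt, classBlock, onesBlock, Matrix.toBlock_apply, hCt, p.2, q.2]
    · rw [hzt, Real.dist_eq]
      simpa only [hr] using hbound a (r b)
  have hB : ((Finset.univ : Finset (Fin k)).offDiag.card : ENNReal) ^ 2 ≠ ⊤ :=
    ENNReal.pow_ne_top (ENNReal.natCast_ne_top _)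
  have hSm : ∀ d, 1 ≤ d → AEMeasurable (S d) (P d) := fun d hd =>
    (Finset.measurable_fun_sum _ fun x _ => (((hmodel d hd).measurable_mean x.1).inner
      ((hmodel d hd).measurable_mean x.2)).abs).aemeasurable
  have hSi := fun d hd => lintegral_crossInner_sq_le hd (hmodel d hd).measurable_mean
    (hmodel d hd).indep_mean (hmodel d hd).law_mean
  have hscalar : ∀ a b, TendstoInProb P (z a b) (l a b) := fun a b =>
    tendstoInProb_of_ae_dist_le hB hSm
      (fun d hd => (hz d hd).mono fun ω hω => (hω a b).2) hSi
  have hblock : ∀ a b, TendstoInProb P (fun d ω => classBlock cls (Cstar d ω) a b)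
      (l a b • onesBlock cls a b) := fun a b =>
    -- The block error is the scalar error times the fixed ones block, hence the extra norm in `K`.
    tendstoInProb_of_ae_dist_le (K := M / τ b * ‖onesBlock cls a b‖) hB hSm
      (fun d hd => (hz d hd).mono fun ω hω => by
        obtain ⟨h1, h2⟩ := hω a b
        rw [h1, dist_eq_norm, ← sub_smul, norm_smul, ← dist_eq_norm, mul_right_comm]
        exact mul_le_mul_of_nonneg_right h2 (norm_nonneg _)) hSi
  refine ⟨fun a => z a a, z, fun d hd => ?_, fun a => ?_, fun a b hab => ?_, fun a => ?_,
    fun a b hab => ?_⟩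
  · filter_upwards [hz d hd] with ω hω
    exact ⟨fun a => (hω a a).1, fun a b _ => (hω a b).1⟩
  · simpa [l] using hscalar a a
  · simpa [l, hab] using hscalar a b
  · simpa [l] using hblock a a
  · simpa [l, hab] using hblock a b
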